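/- Let $a,M,e,\Lambda,q,\mu,m\in\mathbb R$ with $\Lambda\neq0$, $\mu\neq 0$, and $\omega,\lambda\in\mathbb C$ (black hole rotation, mass, charge and cosmological constant; fermion charge, mass, azimuthal number and energy; separation constant). Put $\Xi=1+\frac{a^2\Lambda}{3}$, $$\Delta(r)=\Bigl(1-\tfrac{\Lambda}{3}r^2\Bigr)(r^2+a^2)-2Mr+e^2,\qquad K(r)=\Xi[(r^2+a^2)\omega-ma]+eqr .$$ The radial equation of a massive charged fermion in the Kerr–Newman–(anti) de Sitter spacetime is $$\Delta R''+\Bigl(\tfrac12\Delta'-\tfrac{i\mu\Delta}{\lambda+i\mu r}\Bigr)R'+\Bigl(\tfrac{K^2+\frac i2K\Delta'}{\Delta}-\tfrac{\mu K}{\lambda+i\mu r}-2i\omega\Xi r-ieq-\mu^2r^2-\lambda^2\Bigr)R=0. \tag{1}$$ Assume that $\Delta$ has four distinct zeros $r_1=r_+$, $r_2=r_-$ (real) and $r_3,r_4$ (real or complex), and that $r_5:=i\lambda/\mu$, the zero of $\lambda+i\mu r$, is none of them. Put $z_j=\frac{r_j-r_+}{r_--r_+}$ for $1\le j\le5$ and,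 for $1\le j\le 4$, with all functions evaluated at $r_j$, $$Q_j=\frac{K^2}{\Delta'^2}+\frac{iK}{2\Delta'},\qquad L_j=(r_--r_+)\Bigl[\frac{2KK'\Delta'-K^2\Delta''}{\Delta'^3}+\frac{iK'}{2\Delta'}-\frac1{\Delta'}\Bigl(\frac{\mu K}{\lambda+i\mu r_j}+2i\omega\Xi r_j+ieq+\mu^2r_j^2+\lambda^2\Bigr)\Bigr],$$ and $L_5=i(r_--r_+)K(r_5)/\Delta(r_5)$. For $1\le j\le4$ let $\mu_j$ be either root of $s(s-1)+\frac12s+Q_j=0$. Then $z_1=0$, $z_2=1$, the points $z_1,\dots,z_5$ are distinct, and with $r=r_++z(r_--r_+)$ one has $\Delta(r)=-\frac\Lambda3(r_--r_+)^4z(z-1)(z-z_3)(z-z_4)$. Moreover, with $z$ ranging over any open set $U$ of $\mathbb R$ or of $\mathbb C$ that contains none of $z_1,\dots,z_5$: (a) $R$ solves (1) on the image of $U$ if and only if $R_-(z)=R(r_++z(r_--r_+))$ solves on $U$ $$R_-''+\Bigl[\tfrac12\sum_{j=1}^4\tfrac1{z-z_j}-\tfrac1{z-z_5}\Bigr]R_-'+\Bigl[\sum_{j=1}^4\tfrac{Q_j}{(z-z_j)^2}+\sum_{j=1}^5\tfrac{L_j}{z-z_j}\Bigr]R_-=0.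 \tag{2}$$ The exponents of (2) are $\{\mu_j,\frac12-\mu_j\}$ at $z_j$ for $j\le4$, and $\{0,2\}$ at $z_5$. (b) If $R_-(z)=z^{\mu_1}(z-1)^{\mu_2}(z-z_3)^{\mu_3}(z-z_4)^{\mu_4}\overline R_-(z)$ on $U$, for any differentiable branches of the logarithms of $z-z_j$ on $U$, then $R$ solves (1) on the image of $U$ if and only if $\overline R_-$ solves on $U$ $$\overline R_-''+\Bigl[\sum_{j=1}^4\tfrac{1+4\mu_j}{2(z-z_j)}-\tfrac1{z-z_5}\Bigr]\overline R_-'+\Bigl[\sum_{j=1}^5\tfrac{L_j'}{z-z_j}\Bigr]\overline R_-=0, \tag{3}$$ $$L_j'=L_j+\sum_{k\le4,\,k\ne j}\frac{4\mu_j\mu_k+\mu_j+\mu_k}{2(z_j-z_k)}-\frac{\mu_j}{z_j-z_5}\ (j\le4),\qquad L_5'=L_5-\sum_{k=1}^4\frac{\mu_k}{z_5-z_k}.$$ (c) Equation (3) is Fuchsian (every point of $\mathbb C\cup\{\infty\}$ is an ordinary or a regular singular point), and every point of $\mathbb C\setminus\{0,1,z_3,z_4,z_5\}$ is ordinary. Its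 exponents are $\{0,\frac12-2\mu_j\}$ at $z_j$, $j\le4$, and $\{0,2\}$ at $z_5$. The point $z_5$ is a regular singular point, and so is each $z_j$, $j\le4$, for which $\mu_j\neq-\frac14$ or for which $\omega$ and $r_j$ are real. In particular, if $\omega$ and all $r_1,\dots,r_4$ are real, or if no $\mu_j$ equals $-\frac14$, then (3) has exactly the five finite singular points $0,1,z_3,z_4,z_5$, all regular. -/

import Mathlib

open Filter Topology

noncomputable section

/-! ### Linear second-order equations and their singular points -/

/-- `y` is twice differentiable at every point of the (open) set `U` and satisfies
`A y'' + B y' + C y = 0` there. The independent variable runs over `𝕜`, which is `ℝ` or `ℂ`. -/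
def IsSolutionOn {𝕜 : Type*} [RCLike 𝕜] [NormedAlgebra 𝕜 ℂ]
    (A B C : ℂ → ℂ) (U : Set 𝕜) (y : 𝕜 → ℂ) : Prop :=
  ∃ y₁ y₂ : 𝕜 → ℂ, ∀ x ∈ U, HasDerivAt y (y₁ x) x ∧ HasDerivAt y₁ (y₂ x) x ∧
    A (algebraMap 𝕜 ℂ x) * y₂ x + B (algebraMap 𝕜 ℂ x) * y₁ x + C (algebraMap 𝕜 ℂ x) * y x = 0

/-- Near `z₀` the equation `y'' + p y' + q y = 0` has the form
`y'' + f / (z - z₀) y' + g / (z - z₀)² y = 0` with `f`, `g` analytic at `z₀`,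
`f z₀ = α`, `g z₀ = β`. -/
def HasRegularForm (p q : ℂ → ℂ) (z₀ α β : ℂ) : Prop :=
  ∃ f g : ℂ → ℂ, AnalyticAt ℂ f z₀ ∧ AnalyticAt ℂ g z₀ ∧ f z₀ = α ∧ g z₀ = β ∧
    ∀ᶠ z in 𝓝[≠] z₀, p z = f z / (z - z₀) ∧ q z = g z / (z - z₀) ^ 2

/-- `y'' + p y' + q y = 0` has at `z₀` the exponents `s₁`, `s₂`: they are the roots, with
multiplicity, of the indicial equation `s (s - 1) + α s + β = 0`. -/
def HasExponents (p q : ℂ → ℂ) (z₀ s₁ s₂ : ℂ) : Prop :=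
  ∃ α β : ℂ, HasRegularForm p q z₀ α β ∧
    ∀ s : ℂ, s * (s - 1) + α * s + β = (s - s₁) * (s - s₂)

/-- `z₀` is an ordinary point: `p` and `q` are analytic there (up to removable singularities). -/
def IsOrdinaryPoint (p q : ℂ → ℂ) (z₀ : ℂ) : Prop :=
  ∃ f g : ℂ → ℂ, AnalyticAt ℂ f z₀ ∧ AnalyticAt ℂ g z₀ ∧
    ∀ᶠ z in 𝓝[≠] z₀, p z = f z ∧ q z = g z

/-- `z₀` is a regular singular point: not ordinary, and with poles of order at most `1` and `2`. -/
def IsRegularSingularPoint (p q : ℂ → ℂ) (z₀ : ℂ) : Prop :=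
  ¬ IsOrdinaryPoint p q z₀ ∧ ∃ α β : ℂ, HasRegularForm p q z₀ α β

/-- The equation `y'' + p y' + q y = 0` is Fuchsian: every point of `ℂ` is an ordinary or a regular
singular point, and so is `∞`, that is, the point `t = 0` after the substitution `z = 1 / t`, which
turns the coefficients into `2 / t - p (1 / t) / t²` and `q (1 / t) / t⁴`. -/
def IsFuchsian (p q : ℂ → ℂ) : Prop :=
  (∀ z₀ : ℂ, IsOrdinaryPoint p q z₀ ∨ IsRegularSingularPoint p q z₀) ∧
  (IsOrdinaryPoint (fun t => 2 / t - p t⁻¹ / t ^ 2) (fun t => q t⁻¹ / t ^ 4) 0 ∨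
    IsRegularSingularPoint (fun t => 2 / t - p t⁻¹ / t ^ 2) (fun t => q t⁻¹ / t ^ 4) 0)

/-! ### The radial equation in the Kerr–Newman–de Sitter spacetime -/

/-- Rotation parameter `a`, mass `M`, electric charge `e` and cosmological constant `Λ` of the
black hole; charge `q`, mass `μ`, azimuthal number `m` and energy `ω` of the fermion; separation
constant `lam`. -/
structure KNdS where
  a : ℝ
  M : ℝ
  e : ℝ
  Λ : ℝ
  q : ℝ
  μ : ℝ
  m : ℝ
  ω : ℂ
  lam : ℂ

namespace KNdS

/-- `Ξ = 1 + a² Λ / 3`. -/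
def Xi (P : KNdS) : ℂ := 1 + P.a ^ 2 * P.Λ / 3

/-- `Δ_r = (1 - Λ r² / 3) (r² + a²) - 2 M r + e²`. -/
def Delta (P : KNdS) (r : ℂ) : ℂ :=
  (1 - P.Λ / 3 * r ^ 2) * (r ^ 2 + P.a ^ 2) - 2 * P.M * r + P.e ^ 2

/-- `K(r) = Ξ [(r² + a²) ω - m a] + e q r`. -/
def K (P : KNdS) (r : ℂ) : ℂ :=
  P.Xi * ((r ^ 2 + P.a ^ 2) * P.ω - P.m * P.a) + P.e * P.q * r

/-- Coefficient of `R'` in the radial equation `Δ_r R'' + B R' + C R = 0`. -/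
def radialB (P : KNdS) (r : ℂ) : ℂ :=
  1 / 2 * deriv P.Delta r - Complex.I * P.μ * (P.Delta r / (P.lam + Complex.I * P.μ * r))

/-- Coefficient of `R` in the radial equation `Δ_r R'' + B R' + C R = 0`. -/
def radialC (P : KNdS) (r : ℂ) : ℂ :=
  (P.K r ^ 2 + Complex.I * P.K r / 2 * deriv P.Delta r) / P.Delta r
    - P.μ * P.K r / (P.lam + Complex.I * P.μ * r)
    - 2 * Complex.I * P.ω * r * P.Xi - Complex.I * P.e * P.q - P.μ ^ 2 * r ^ 2 - P.lam ^ 2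

/-- The radii `r₊, r₋, r_Λ⁺, r_Λ⁻`, in this order. -/
def radius (rp rm : ℝ) (r₃ r₄ : ℂ) : Fin 4 → ℂ := ![(rp : ℂ), (rm : ℂ), r₃, r₄]

/-- `r₅ = i λ / μ`, the zero of `λ + i μ r`. -/
def r₅ (P : KNdS) : ℂ := Complex.I * P.lam / P.μ

/-- The affine coordinate `z = (r - r₊) / (r₋ - r₊)` of a radius `r`. -/
def zOf (rp rm : ℝ) (r : ℂ) : ℂ := (r - rp) / (rm - rp)

/-- Coefficient of `(z - zᵢ)⁻²`, where `rᵢ` is a zero of `Δ_r`. -/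
def Q (P : KNdS) (rᵢ : ℂ) : ℂ :=
  P.K rᵢ ^ 2 / deriv P.Delta rᵢ ^ 2 + Complex.I * P.K rᵢ / (2 * deriv P.Delta rᵢ)

/-- Coefficient of `(z - zᵢ)⁻¹`, where `rᵢ` is a zero of `Δ_r`. -/
def L (P : KNdS) (rp rm : ℝ) (rᵢ : ℂ) : ℂ :=
  (rm - rp) *
    ((2 * P.K rᵢ * deriv P.K rᵢ * deriv P.Delta rᵢ - P.K rᵢ ^ 2 * deriv (deriv P.Delta) rᵢ)
        / deriv P.Delta rᵢ ^ 3
      + Complex.I * deriv P.K rᵢ / (2 * deriv P.Delta rᵢ)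
      - (P.μ * P.K rᵢ / (P.lam + Complex.I * P.μ * rᵢ) + 2 * Complex.I * P.ω * P.Xi * rᵢ
          + Complex.I * P.e * P.q + P.μ ^ 2 * rᵢ ^ 2 + P.lam ^ 2) / deriv P.Delta rᵢ)

/-- Coefficient of `(z - z₅)⁻¹`. -/
def L₅ (P : KNdS) (rp rm : ℝ) : ℂ :=
  Complex.I * (rm - rp) * P.K P.r₅ / P.Delta P.r₅

/-- Coefficient of `R₋'` in the radial equation in the variable `z`; here `z = (z₁, …, z₄)`. -/
def preB (z : Fin 4 → ℂ) (z₅ x : ℂ) : ℂ :=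
  1 / 2 * ∑ i, 1 / (x - z i) - 1 / (x - z₅)

/-- Coefficient of `R₋` in the radial equation in the variable `z`. -/
def preC (z Q L : Fin 4 → ℂ) (z₅ L₅ x : ℂ) : ℂ :=
  ∑ i, Q i / (x - z i) ^ 2 + ∑ i, L i / (x - z i) + L₅ / (x - z₅)

/-- `L'ᵢ`, for `i = 1, …, 4`; here `ν i` is the exponent of `z - zᵢ` in the F-homotopic
transformation. -/
def L' (z ν L : Fin 4 → ℂ) (z₅ : ℂ) (i : Fin 4) : ℂ :=
  L i + ∑ j ∈ Finset.univ.erase i, (4 * ν i * ν j + ν i + ν j) / (2 * (z i - z j))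
    - ν i / (z i - z₅)

/-- `L'₅`. -/
def L₅' (z ν : Fin 4 → ℂ) (z₅ L₅ : ℂ) : ℂ := L₅ - ∑ i, ν i / (z₅ - z i)

/-- Coefficient of `R̄₋'` in the transformed equation. -/
def finalB (z ν : Fin 4 → ℂ) (z₅ x : ℂ) : ℂ :=
  ∑ i, (1 + 4 * ν i) / (2 * (x - z i)) - 1 / (x - z₅)

/-- Coefficient of `R̄₋` in the transformed equation. -/
def finalC (z ν L : Fin 4 → ℂ) (z₅ L₅ x : ℂ) : ℂ :=
  ∑ i, L' z ν L z₅ i / (x - z i) + L₅' z ν z₅ L₅ / (x - z₅)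

end KNdS

end

/-!
After division by `Δ`, the coefficients of the radial equation are rational functions of `r` whose
poles are the simple zeros of `Δ` and `r₅`. Up to a polynomial of degree `2` divided by `Δ`, the
coefficient of `R` is the product of the two sums of simple poles `K / Δ` and
`K / Δ + i Δ' / (2 Δ) + i / (r - r₅)`. The product of two such sums, with residues `aᵢ` and `bᵢ` at
`wᵢ`, has the double poles `aᵢ bᵢ / (x - wᵢ) ^ 2`, which here give `Qᵢ`, and the residues
`∑ j ≠ i, (aᵢ bⱼ + aⱼ bᵢ) / (wᵢ - wⱼ)`, which here give `Lᵢ`. The summands are antisymmetric in `i`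
and `j`, so these residues add up to `0`; the polynomial divided by `Δ` decays like `r ^ (-2)`, so
its residues add up to `0` as well. The vanishing of the sum of the residues is what makes `∞` at
most a regular singular point.

Writing a solution as `E y` with `E' / E = s` replaces the coefficients `p`, `q` by `p + 2 s` and
`q + p s + s ^ 2 + s'`. For `s = ∑ i, νᵢ / (x - zᵢ)` the same product formula shows that the double
poles disappear exactly when every `νᵢ` solves its indicial equation. That equation has the roots
`i K / Δ'` and `1 / 2 - i K / Δ'`, whose real parts are `0` and `1 / 2` when `K / Δ'` is real, so
`νᵢ = -1 / 4` is then impossible.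
-/

section PoleSum

variable {F ι : Type*} [Field F] [Fintype ι]

/-- The sum of principal parts `∑ i, a i / (x - w i) ^ k`. The coefficients of a Fuchsian equation
are sums of such terms. -/
def poleSum (w a : ι → F) (k : ℕ) (x : F) : F := ∑ i, a i / (x - w i) ^ k

/-- The residue at `w i` of the product of the two sums of simple poles with residues `a` and `b`.
The term `j = i` is `0` because `x / 0 = 0`. -/
def crossResidue (w a b : ι → F) (i : ι) : F := ∑ j, (a i * b j + a j * b i) / (w i - w j)

theorem poleSum_add (w a b : ι → F) (k : ℕ) (x : F) :
    poleSum w (a + b) k x = poleSum w a k x + poleSum w b k x := by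
  simp only [poleSum, Pi.add_apply, add_div, Finset.sum_add_distrib]

theorem poleSum_sub (w a b : ι → F) (k : ℕ) (x : F) :
    poleSum w (a - b) k x = poleSum w a k x - poleSum w b k x := by
  simp only [poleSum, Pi.sub_apply, sub_div, Finset.sum_sub_distrib]

theorem poleSum_smul (w a : ι → F) (c : F) (k : ℕ) (x : F) :
    poleSum w (c • a) k x = c * poleSum w a k x := by
  simp only [poleSum, Pi.smul_apply, smul_eq_mul, mul_div_assoc, Finset.mul_sum]

theorem poleSum_mul {w : ι → F} (hw : Function.Injective w) (a b : ι → F) {x : F}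
    (hx : ∀ i, x ≠ w i) :
    poleSum w a 1 x * poleSum w b 1 x =
      poleSum w (a * b) 2 x + poleSum w (crossResidue w a b) 1 x := by
  classical
  have partial_fractions (i j : ι) : a i / (x - w i) * (b j / (x - w j)) =
      (if i = j then a i * b i / (x - w i) ^ 2 else 0) +
        (a i * b j / (w i - w j) / (x - w i) + a i * b j / (w j - w i) / (x - w j)) := by
    have hi := sub_ne_zero.2 (hx i)
    have hj := sub_ne_zero.2 (hx j)
    split_ifs with h
    · subst h
      simp only [sub_self, div_zero, zero_div, add_zero]
      field_simp
    · have hij := sub_ne_zero.2 (hw.ne h)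
      rw [← neg_sub (w i) (w j), zero_add]
      field_simp
      ring
  simp only [poleSum, crossResidue, pow_one, Finset.sum_mul_sum, partial_fractions,
    Finset.sum_add_distrib, Finset.sum_ite_eq, Finset.mem_univ, if_true, Pi.mul_apply]
  rw [Finset.sum_comm (f := fun i j => a i * b j / (w j - w i) / (x - w j)),
    ← Finset.sum_add_distrib]
  simp only [add_div, Finset.sum_div, Finset.sum_add_distrib]

theorem sum_crossResidue (w a b : ι → F) : ∑ i, crossResidue w a b i = 0 := by
  simp only [crossResidue, add_div, Finset.sum_add_distrib]
  rw [Finset.sum_comm (f := fun i j => a j * b i / (w i - w j)), ← Finset.sum_add_distrib]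
  refine Finset.sum_eq_zero fun i _ => ?_
  rw [← Finset.sum_add_distrib]
  refine Finset.sum_eq_zero fun j _ => ?_
  rw [← neg_sub (w i) (w j), div_neg, add_neg_cancel]

theorem poleSum_affine (v a : ι → F) (k : ℕ) {c : F} (hc : c ≠ 0) (b x : F) :
    poleSum (fun i => (v i - b) / c) a k x = c ^ k * poleSum v a k (b + x * c) := by
  rw [poleSum, poleSum, Finset.mul_sum]
  refine Finset.sum_congr rfl fun i _ => ?_
  rw [show x - (v i - b) / c = (b + x * c - v i) / c by field_simp; ring, div_pow]
  field_simp

theorem poleSum_eq_add_update [DecidableEq ι] (w a : ι → F) (k : ℕ) (i : ι)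
    (x : F) :
    poleSum w a k x = a i / (x - w i) ^ k + poleSum w (Function.update a i 0) k x := by
  simp only [poleSum]
  rw [← Finset.add_sum_erase _ _ (Finset.mem_univ i), ← Finset.add_sum_erase _
    (fun j => Function.update a i 0 j / (x - w j) ^ k) (Finset.mem_univ i),
    Function.update_self, zero_div, zero_add]
  refine congrArg _ (Finset.sum_congr rfl fun j hj => ?_)
  rw [Function.update_of_ne (Finset.ne_of_mem_erase hj)]

theorem poleSum_inv (w a : ι → F) (k : ℕ) {t : F} (ht : t ≠ 0) :
    poleSum w a k t⁻¹ = t ^ k * ∑ i, a i / (1 - w i * t) ^ k := by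
  rw [poleSum, Finset.mul_sum]
  refine Finset.sum_congr rfl fun i _ => ?_
  rw [show t⁻¹ - w i = (1 - w i * t) / t by field_simp, div_pow, div_div_eq_mul_div]
  ring

theorem poleSum_inv_of_sum_eq_zero (w : ι → F) {a : ι → F}
    (ha : ∑ i, a i = 0) {t : F} (ht : t ≠ 0) (hwt : ∀ i, 1 - w i * t ≠ 0) :
    poleSum w a 1 t⁻¹ = t ^ 2 * ∑ i, a i * w i / (1 - w i * t) := by
  have hterm (i : ι) : a i / (1 - w i * t) ^ 1 = a i + t * (a i * w i / (1 - w i * t)) := by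
    have := hwt i
    field_simp
    ring
  rw [poleSum_inv w a 1 ht, Finset.sum_congr rfl fun i _ => hterm i, Finset.sum_add_distrib, ha,
    ← Finset.mul_sum]
  ring

theorem crossResidue_add_smul_one (w a : ι → F) (c : F) (i : ι) :
    crossResidue w a (a + c • 1) i =
      (2 * a i + c) * ∑ j, a j / (w i - w j) + c * a i * ∑ j, 1 / (w i - w j) := by
  rw [crossResidue, Finset.mul_sum, Finset.mul_sum, ← Finset.sum_add_distrib]
  refine Finset.sum_congr rfl fun j _ => ?_
  simp only [Pi.add_apply, Pi.smul_apply, Pi.one_apply, smul_eq_mul]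
  ring

theorem optionElim'_injective {α β : Type*} {f : α → β} {b : β} (hf : Function.Injective f)
    (hb : ∀ x, b ≠ f x) : Function.Injective (Option.elim' b f) :=
  Option.injective_iff.2 ⟨hf, fun ⟨x, hx⟩ => hb x hx.symm⟩

theorem poleSum_elim' (w₀ a₀ : F) (w a : ι → F) (k : ℕ) (x : F) :
    poleSum (Option.elim' w₀ w) (Option.elim' a₀ a) k x = a₀ / (x - w₀) ^ k + poleSum w a k x :=
  Fintype.sum_option _

theorem crossResidue_elim'_none (w₀ a₀ b₀ : F) (w a b : ι → F) :
    crossResidue (Option.elim' w₀ w) (Option.elim' a₀ a) (Option.elim' b₀ b) none =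
      ∑ j, (a₀ * b j + a j * b₀) / (w₀ - w j) := by
  simp only [crossResidue, Fintype.sum_option, Option.elim'_none, Option.elim'_some, sub_self,
    div_zero, zero_add]

theorem crossResidue_elim'_some (w₀ a₀ b₀ : F) (w a b : ι → F) (i : ι) :
    crossResidue (Option.elim' w₀ w) (Option.elim' a₀ a) (Option.elim' b₀ b) (some i) =
      (a i * b₀ + a₀ * b i) / (w i - w₀) + crossResidue w a b i := by
  simp only [crossResidue, Fintype.sum_option, Option.elim'_none, Option.elim'_some]

end PoleSum

section SimpleRoots

open Polynomial

variable {F ι : Type*} [Field F] [Fintype ι]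

/-- The polynomial `W` splits with the simple roots `v i`, `i : ι`: it is the denominator of the
partial fraction expansions below. -/
structure HasSimpleRoots (W : F[X]) (v : ι → F) : Prop where
  injective : Function.Injective v
  degree_eq : W.degree = Fintype.card ι
  eval_eq_zero : ∀ i, W.eval (v i) = 0

namespace HasSimpleRoots

variable {W N : F[X]} {v : ι → F}

theorem ne_zero (h : HasSimpleRoots W v) : W ≠ 0 := by
  rintro rfl
  simpa using h.degree_eq

theorem eq_prod (h : HasSimpleRoots W v) :
    W = C W.leadingCoeff * ∏ i, (X - C (v i)) := by
  have hprod : (∏ i, (X - C (v i))).degree = (Fintype.card ι : WithBot ℕ) := by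
    simp [degree_prod, degree_X_sub_C]
  refine eq_of_degree_sub_lt_of_eval_index_eq Finset.univ h.injective.injOn ?_ fun i _ => ?_
  · rw [Finset.card_univ, ← h.degree_eq]
    refine degree_sub_lt_left ?_ h.ne_zero ?_
    · rw [degree_C_mul (leadingCoeff_ne_zero.2 h.ne_zero), hprod, h.degree_eq]
    · rw [leadingCoeff_mul, leadingCoeff_C, (monic_prod_X_sub_C v Finset.univ).leadingCoeff,
        mul_one]
  · rw [h.eval_eq_zero, eval_mul, eval_prod,
      Finset.prod_eq_zero (Finset.mem_univ i) (by rw [eval_sub, eval_X, eval_C, sub_self]),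
      mul_zero]

theorem eval_eq_prod (h : HasSimpleRoots W v) (x : F) :
    W.eval x = W.leadingCoeff * ∏ i, (x - v i) := by
  conv_lhs => rw [h.eq_prod]
  simp only [eval_mul, eval_C, eval_prod, eval_sub, eval_X]

theorem eval_ne_zero (h : HasSimpleRoots W v) {x : F} (hx : ∀ i, x ≠ v i) : W.eval x ≠ 0 := by
  rw [h.eval_eq_prod]
  exact mul_ne_zero (leadingCoeff_ne_zero.2 h.ne_zero)
    (Finset.prod_ne_zero_iff.2 fun i _ => sub_ne_zero.2 (hx i))

theorem mul_divByMonic (h : HasSimpleRoots W v) (i : ι) :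
    (X - C (v i)) * (W /ₘ (X - C (v i))) = W :=
  mul_divByMonic_eq_iff_isRoot.2 (h.eval_eq_zero i)

theorem degree_divByMonic_lt (h : HasSimpleRoots W v) (i : ι) :
    (W /ₘ (X - C (v i))).degree < Fintype.card ι :=
  h.degree_eq ▸ Polynomial.degree_divByMonic_lt W _ h.ne_zero (by rw [degree_X_sub_C]; decide)

theorem eval_divByMonic (h : HasSimpleRoots W v) (i : ι) {x : F} (hx : x ≠ v i) :
    (W /ₘ (X - C (v i))).eval x = W.eval x / (x - v i) := by
  rw [eq_div_iff (sub_ne_zero.2 hx), mul_comm]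
  simpa only [eval_mul, eval_sub, eval_X, eval_C] using congrArg (eval x) (h.mul_divByMonic i)

theorem derivative_eq (h : HasSimpleRoots W v) (i : ι) :
    derivative W = W /ₘ (X - C (v i)) + (X - C (v i)) * derivative (W /ₘ (X - C (v i))) := by
  conv_lhs => rw [← h.mul_divByMonic i, derivative_mul, derivative_X_sub_C, one_mul]

theorem eval_divByMonic_self (h : HasSimpleRoots W v) (i : ι) :
    (W /ₘ (X - C (v i))).eval (v i) = (derivative W).eval (v i) := by
  rw [h.derivative_eq i, eval_add, eval_mul, eval_sub, eval_X, eval_C, sub_self, zero_mul,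
    add_zero]

theorem eval_derivative_ne_zero (h : HasSimpleRoots W v) (i : ι) :
    (derivative W).eval (v i) ≠ 0 := by
  intro h0
  have hzero : W /ₘ (X - C (v i)) = 0 := by
    refine eq_zero_of_degree_lt_of_eval_index_eq_zero Finset.univ h.injective.injOn
      (h.degree_divByMonic_lt i) fun j _ => ?_
    rcases eq_or_ne j i with rfl | hji
    · rw [h.eval_divByMonic_self, h0]
    · rw [h.eval_divByMonic i (h.injective.ne hji), h.eval_eq_zero, zero_div]
  exact h.ne_zero (by rw [← h.mul_divByMonic i, hzero, mul_zero])

/-- The residue of `N / W` at the simple root `v i` of `W`. -/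
noncomputable def residue (N W : F[X]) (v : ι → F) (i : ι) : F :=
  N.eval (v i) / (derivative W).eval (v i)

theorem eq_sum_residue_mul (h : HasSimpleRoots W v) (hN : N.degree < Fintype.card ι) :
    N = ∑ i, C (residue N W v i) * (W /ₘ (X - C (v i))) := by
  refine eq_of_degrees_lt_of_eval_index_eq Finset.univ h.injective.injOn hN ?_ fun i _ => ?_
  · refine (degree_sum_le _ _).trans_lt ((Finset.sup_lt_iff (WithBot.bot_lt_coe _)).2 fun i _ => ?_)
    rw [C_mul']
    exact (degree_smul_le _ _).trans_lt (h.degree_divByMonic_lt i)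
  · rw [eval_finsetSum, Finset.sum_eq_single i]
    · rw [eval_mul, eval_C, h.eval_divByMonic_self, residue,
        div_mul_cancel₀ _ (h.eval_derivative_ne_zero i)]
    · intro j _ hji
      rw [eval_mul, h.eval_divByMonic j (h.injective.ne hji.symm), h.eval_eq_zero, zero_div,
        mul_zero]
    · exact fun hi => absurd (Finset.mem_univ i) hi

theorem eval_div_eval (h : HasSimpleRoots W v) (hN : N.degree < Fintype.card ι) {x : F}
    (hx : ∀ i, x ≠ v i) : N.eval x / W.eval x = poleSum v (residue N W v) 1 x := by
  rw [div_eq_iff (h.eval_ne_zero hx)]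
  conv_lhs => rw [h.eq_sum_residue_mul hN]
  simp only [eval_finsetSum, eval_mul, eval_C, poleSum, Finset.sum_mul, pow_one,
    h.eval_divByMonic _ (hx _), mul_div_assoc', div_mul_eq_mul_div]

theorem sum_residue (h : HasSimpleRoots W v) (hN : N.degree < Fintype.card ι) :
    ∑ i, residue N W v i = N.coeff (Fintype.card ι - 1) / W.leadingCoeff := by
  have hcoeff (i : ι) : (W /ₘ (X - C (v i))).coeff (Fintype.card ι - 1) = W.leadingCoeff := by
    have hdeg : (W /ₘ (X - C (v i))).natDegree = Fintype.card ι - 1 := by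
      rw [natDegree_divByMonic _ (monic_X_sub_C _), natDegree_X_sub_C,
        natDegree_eq_of_degree_eq_some h.degree_eq]
    rw [← hdeg, coeff_natDegree, leadingCoeff_divByMonic_X_sub_C]
    have : Nonempty ι := ⟨i⟩
    rw [h.degree_eq]
    exact_mod_cast Fintype.card_ne_zero
  rw [eq_div_iff (leadingCoeff_ne_zero.2 h.ne_zero)]
  conv_rhs => rw [h.eq_sum_residue_mul hN]
  simp only [finsetSum_coeff, coeff_C_mul, hcoeff, Finset.sum_mul]

theorem derivative_divByMonic_self (h : HasSimpleRoots W v) (i : ι) :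
    2 * (derivative (W /ₘ (X - C (v i)))).eval (v i) =
      (derivative (derivative W)).eval (v i) := by
  rw [h.derivative_eq i, derivative_add, derivative_mul, derivative_X_sub_C]
  simp only [eval_add, eval_mul, eval_sub, eval_X, eval_C, sub_self, eval_one]
  ring

theorem derivative_divByMonic_of_ne (h : HasSimpleRoots W v) {i j : ι} (hji : j ≠ i) :
    (derivative (W /ₘ (X - C (v j)))).eval (v i) = (derivative W).eval (v i) / (v i - v j) := by
  have hij := h.injective.ne hji.symm
  rw [h.derivative_eq j, eval_add, h.eval_divByMonic j hij, h.eval_eq_zero, zero_div, zero_add,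
    eval_mul, eval_sub, eval_X, eval_C, mul_div_cancel_left₀ _ (sub_ne_zero.2 hij)]

/-- The left-hand side is the value at `v i` of the regular part of `N / W`: its term `j = i` is `0`
because `x / 0 = 0`. -/
theorem sum_residue_div [NeZero (2 : F)] (h : HasSimpleRoots W v)
    (hN : N.degree < Fintype.card ι) (i : ι) :
    ∑ j, residue N W v j / (v i - v j) =
      (derivative N).eval (v i) / (derivative W).eval (v i) -
        N.eval (v i) * (derivative (derivative W)).eval (v i) /
          (2 * (derivative W).eval (v i) ^ 2) := by
  classical
  have hW := h.eval_derivative_ne_zero i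
  have hterm (j : ι) : residue N W v j * (derivative (W /ₘ (X - C (v j)))).eval (v i) =
      (derivative W).eval (v i) * (residue N W v j / (v i - v j)) +
        if i = j then residue N W v i * (derivative (W /ₘ (X - C (v i)))).eval (v i) else 0 := by
    split_ifs with hij
    · rw [hij, sub_self, div_zero, mul_zero, zero_add]
    · rw [h.derivative_divByMonic_of_ne (Ne.symm hij), add_zero]
      ring
  have hderiv : (derivative N).eval (v i) =
      (derivative W).eval (v i) * ∑ j, residue N W v j / (v i - v j) +
        residue N W v i * (derivative (W /ₘ (X - C (v i)))).eval (v i) := by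
    conv_lhs => rw [h.eq_sum_residue_mul hN]
    simp only [derivative_sum, derivative_C_mul, eval_finsetSum, eval_mul, eval_C, Finset.mul_sum]
    rw [Finset.sum_congr rfl fun j _ => hterm j, Finset.sum_add_distrib, Finset.sum_ite_eq,
      if_pos (Finset.mem_univ i)]
  rw [hderiv, ← h.derivative_divByMonic_self i, residue]
  have h2 : (2 : F) ≠ 0 := two_ne_zero
  field_simp
  ring

theorem residue_derivative (h : HasSimpleRoots W v) : residue (derivative W) W v = 1 :=
  funext fun i => div_self (h.eval_derivative_ne_zero i)

theorem degree_derivative_lt (h : HasSimpleRoots W v) : (derivative W).degree < Fintype.card ι :=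
  h.degree_eq ▸ Polynomial.degree_derivative_lt h.ne_zero

theorem sum_one_div_sub [NeZero (2 : F)] (h : HasSimpleRoots W v) (i : ι) :
    ∑ j, 1 / (v i - v j) =
      (derivative (derivative W)).eval (v i) / (2 * (derivative W).eval (v i)) := by
  have h2 : (2 : F) ≠ 0 := two_ne_zero
  have hW := h.eval_derivative_ne_zero i
  have hsum := h.sum_residue_div h.degree_derivative_lt i
  rw [h.residue_derivative] at hsum
  refine hsum.trans ?_
  field_simp
  ring

end HasSimpleRoots

end SimpleRoots

section Solutions

variable {𝕜 : Type*} [RCLike 𝕜] [NormedAlgebra 𝕜 ℂ]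

theorem hasDerivAt_algebraMap (x : 𝕜) : HasDerivAt (algebraMap 𝕜 ℂ) 1 x := by
  have h := (algebraMapCLM 𝕜 ℂ).hasDerivAt (x := x)
  rwa [algebraMapCLM_apply, map_one] at h

variable {A B C p q s s' : ℂ → ℂ} {U V : Set 𝕜} {R y y' E w : 𝕜 → ℂ}

theorem IsSolutionOn.congr (h : IsSolutionOn A B C U y) (hU : IsOpen U) (hy : Set.EqOn y' y U) :
    IsSolutionOn A B C U y' := by
  obtain ⟨y₁, y₂, h⟩ := h
  refine ⟨y₁, y₂, fun x hx => ⟨?_, (h x hx).2.1, hy hx ▸ (h x hx).2.2⟩⟩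
  exact (h x hx).1.congr_of_eventuallyEq (hy.eventuallyEq_of_mem (hU.mem_nhds hx))

theorem isSolutionOn_congr (hU : IsOpen U) (hy : Set.EqOn y' y U) :
    IsSolutionOn A B C U y' ↔ IsSolutionOn A B C U y :=
  ⟨fun h => h.congr hU hy.symm, fun h => h.congr hU hy⟩

theorem isSolutionOn_iff_div (hA : ∀ x ∈ U, A (algebraMap 𝕜 ℂ x) ≠ 0)
    (hp : ∀ x ∈ U, B (algebraMap 𝕜 ℂ x) / A (algebraMap 𝕜 ℂ x) = p (algebraMap 𝕜 ℂ x))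
    (hq : ∀ x ∈ U, C (algebraMap 𝕜 ℂ x) / A (algebraMap 𝕜 ℂ x) = q (algebraMap 𝕜 ℂ x)) :
    IsSolutionOn A B C U y ↔ IsSolutionOn 1 p q U y := by
  refine exists₂_congr fun y₁ y₂ => forall₂_congr fun x hx => ?_
  have hx₀ := hA x hx
  have hA_mul : A (algebraMap 𝕜 ℂ x) * y₂ x + B (algebraMap 𝕜 ℂ x) * y₁ x
        + C (algebraMap 𝕜 ℂ x) * y x =
      A (algebraMap 𝕜 ℂ x) * ((1 : ℂ → ℂ) (algebraMap 𝕜 ℂ x) * y₂ x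
        + p (algebraMap 𝕜 ℂ x) * y₁ x + q (algebraMap 𝕜 ℂ x) * y x) := by
    rw [← hp x hx, ← hq x hx, Pi.one_apply]
    field_simp
  rw [hA_mul, mul_eq_zero_iff_left hx₀]

theorem IsSolutionOn.comp_affine (h : IsSolutionOn A B C V R) (b c : 𝕜) :
    IsSolutionOn (fun z => A (algebraMap 𝕜 ℂ b + z * algebraMap 𝕜 ℂ c))
      (fun z => algebraMap 𝕜 ℂ c * B (algebraMap 𝕜 ℂ b + z * algebraMap 𝕜 ℂ c))
      (fun z => algebraMap 𝕜 ℂ c ^ 2 * C (algebraMap 𝕜 ℂ b + z * algebraMap 𝕜 ℂ c))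
      ((fun x => b + x * c) ⁻¹' V) (fun x => R (b + x * c)) := by
  obtain ⟨R₁, R₂, h⟩ := h
  have chain_rule {S S' : 𝕜 → ℂ} {x : 𝕜} (hS : HasDerivAt S (S' (b + x * c)) (b + x * c)) :
      HasDerivAt (fun t => S (b + t * c)) (algebraMap 𝕜 ℂ c * S' (b + x * c)) x := by
    have hg : HasDerivAt (fun t => b + t * c) c x := by
      simpa only [id, one_mul] using ((hasDerivAt_id x).mul_const c).const_add b
    rw [← Algebra.smul_def]
    exact hS.scomp x hg
  refine ⟨fun x => algebraMap 𝕜 ℂ c * R₁ (b + x * c),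
    fun x => algebraMap 𝕜 ℂ c * (algebraMap 𝕜 ℂ c * R₂ (b + x * c)), fun x hx => ?_⟩
  obtain ⟨h₁, h₂, heq⟩ := h _ hx
  refine ⟨chain_rule h₁, (chain_rule h₂).const_mul _, ?_⟩
  rw [map_add, map_mul] at heq
  linear_combination algebraMap 𝕜 ℂ c ^ 2 * heq

theorem isSolutionOn_image_affine_iff {c : 𝕜} (hc : c ≠ 0) (b : 𝕜) :
    IsSolutionOn A B C ((fun x => b + x * c) '' U) R ↔
      IsSolutionOn (fun z => A (algebraMap 𝕜 ℂ b + z * algebraMap 𝕜 ℂ c))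
        (fun z => algebraMap 𝕜 ℂ c * B (algebraMap 𝕜 ℂ b + z * algebraMap 𝕜 ℂ c))
        (fun z => algebraMap 𝕜 ℂ c ^ 2 * C (algebraMap 𝕜 ℂ b + z * algebraMap 𝕜 ℂ c))
        U (fun x => R (b + x * c)) := by
  have left_inv : Function.LeftInverse (fun r => -(b / c) + r * c⁻¹) (fun x => b + x * c) :=
    fun x => by field_simp; ring
  have right_inv : Function.RightInverse (fun r => -(b / c) + r * c⁻¹) (fun x => b + x * c) :=
    fun r => by field_simp; ring
  refine ⟨fun h => ?_, fun h => ?_⟩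
  · have hU : (fun x => b + x * c) ⁻¹' ((fun x => b + x * c) '' U) = U :=
      Set.preimage_image_eq U left_inv.injective
    simpa only [hU] using h.comp_affine b c
  · have hU : (fun r => -(b / c) + r * c⁻¹) ⁻¹' U = (fun x => b + x * c) '' U :=
      (congrFun (Set.image_eq_preimage_of_inverse left_inv right_inv) U).symm
    have hc' : algebraMap 𝕜 ℂ c ≠ 0 := (map_ne_zero _).2 hc
    have right_inv' (z : ℂ) : algebraMap 𝕜 ℂ b +
        (-(algebraMap 𝕜 ℂ b / algebraMap 𝕜 ℂ c) + z * (algebraMap 𝕜 ℂ c)⁻¹) *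
          algebraMap 𝕜 ℂ c = z := by
      field_simp; ring
    simpa only [hU, right_inv _, map_neg, map_div₀, map_inv₀, right_inv',
      inv_mul_cancel_left₀ hc', inv_pow, inv_mul_cancel_left₀ (pow_ne_zero 2 hc')]
      using h.comp_affine (-(b / c)) c⁻¹

theorem IsSolutionOn.mul_of_logDeriv (h : IsSolutionOn 1 (p + 2 * s) (q + p * s + s ^ 2 + s') U w)
    (hE : ∀ x ∈ U, HasDerivAt E (s (algebraMap 𝕜 ℂ x) * E x) x)
    (hs : ∀ x ∈ U, HasDerivAt s (s' (algebraMap 𝕜 ℂ x)) (algebraMap 𝕜 ℂ x)) :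
    IsSolutionOn 1 p q U (E * w) := by
  obtain ⟨w₁, w₂, h⟩ := h
  refine ⟨fun x => s (algebraMap 𝕜 ℂ x) * E x * w x + E x * w₁ x,
    fun x => (s' (algebraMap 𝕜 ℂ x) * E x + s (algebraMap 𝕜 ℂ x) * (s (algebraMap 𝕜 ℂ x) * E x)) *
      w x + s (algebraMap 𝕜 ℂ x) * E x * w₁ x +
        (s (algebraMap 𝕜 ℂ x) * E x * w₁ x + E x * w₂ x), fun x hx => ?_⟩
  obtain ⟨h₁, h₂, heq⟩ := h x hx
  have hs𝕜 : HasDerivAt (fun t => s (algebraMap 𝕜 ℂ t)) (s' (algebraMap 𝕜 ℂ x)) x := by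
    simpa only [one_smul, Function.comp_def] using (hs x hx).scomp x (hasDerivAt_algebraMap x)
  refine ⟨(hE x hx).mul h₁, ((hs𝕜.mul (hE x hx)).mul h₁).add ((hE x hx).mul h₂), ?_⟩
  simp only [Pi.add_apply, Pi.mul_apply, Pi.pow_apply, Pi.ofNat_apply] at heq ⊢
  linear_combination E x * heq

theorem isSolutionOn_mul_iff (hU : IsOpen U) (hE₀ : ∀ x ∈ U, E x ≠ 0)
    (hE : ∀ x ∈ U, HasDerivAt E (s (algebraMap 𝕜 ℂ x) * E x) x)
    (hs : ∀ x ∈ U, HasDerivAt s (s' (algebraMap 𝕜 ℂ x)) (algebraMap 𝕜 ℂ x)) :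
    IsSolutionOn 1 p q U (E * w) ↔
      IsSolutionOn 1 (p + 2 * s) (q + p * s + s ^ 2 + s') U w := by
  refine ⟨fun h => ?_, fun h => h.mul_of_logDeriv hE hs⟩
  have hp : p = p + 2 * s + 2 * -s := by ring
  have hq : q = q + p * s + s ^ 2 + s' + (p + 2 * s) * -s + (-s) ^ 2 + -s' := by ring
  rw [hp, hq] at h
  refine (h.mul_of_logDeriv (E := E⁻¹) (fun x hx => ?_) fun x hx => (hs x hx).neg).congr hU
    fun x hx => (inv_mul_cancel_left₀ (hE₀ x hx) (w x)).symm
  have hinv : (-s) (algebraMap 𝕜 ℂ x) * E⁻¹ x = -(s (algebraMap 𝕜 ℂ x) * E x) / E x ^ 2 := by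
    have := hE₀ x hx
    simp only [Pi.neg_apply, Pi.inv_apply]
    field_simp
  rw [hinv]
  exact (hE x hx).inv (hE₀ x hx)

end Solutions

section PoleSumCoefficients

variable {ι : Type*} [Fintype ι] {w : ι → ℂ}

theorem analyticAt_poleSum {a : ι → ℂ} (k : ℕ) {x : ℂ} (hx : ∀ i, x = w i → a i = 0) :
    AnalyticAt ℂ (poleSum w a k) x := by
  refine Finset.analyticAt_fun_sum _ fun i _ => ?_
  by_cases hi : x = w i
  · simpa only [hx i hi, zero_div] using analyticAt_const
  · exact analyticAt_const.fun_div ((analyticAt_id.fun_sub analyticAt_const).fun_pow k)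
      (pow_ne_zero k (sub_ne_zero.2 hi))

theorem hasDerivAt_poleSum (a : ι → ℂ) {x : ℂ} (hx : ∀ i, x ≠ w i) :
    HasDerivAt (poleSum w a 1) (-poleSum w a 2 x) x := by
  simp only [poleSum, ← Finset.sum_neg_distrib]
  refine HasDerivAt.fun_sum fun i _ => ?_
  simpa [neg_div] using (hasDerivAt_const x (a i)).fun_div ((hasDerivAt_id x).sub_const (w i))
    (sub_ne_zero.2 (hx i))

variable (w) (a b c : ι → ℂ)

theorem isOrdinaryPoint_poleSum {x : ℂ} (hx : ∀ i, x ≠ w i) :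
    IsOrdinaryPoint (poleSum w a 1) (poleSum w b 2 + poleSum w c 1) x := by
  have analytic (a : ι → ℂ) (k : ℕ) : AnalyticAt ℂ (poleSum w a k) x :=
    analyticAt_poleSum k fun i hi => absurd hi (hx i)
  exact ⟨_, _, analytic a 1, (analytic b 2).add (analytic c 1), .of_forall fun _ => ⟨rfl, rfl⟩⟩

variable {w}

theorem hasRegularForm_poleSum (hw : Function.Injective w) (i : ι) :
    HasRegularForm (poleSum w a 1) (poleSum w b 2 + poleSum w c 1) (w i) (a i) (b i) := by
  classical
  have analytic (a : ι → ℂ) (k : ℕ) : AnalyticAt ℂ (poleSum w (Function.update a i 0) k) (w i) :=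
    analyticAt_poleSum k fun j hj => by rw [← hw hj, Function.update_self]
  have hlin : AnalyticAt ℂ (fun z => z - w i) (w i) := analyticAt_id.fun_sub analyticAt_const
  refine ⟨fun z => a i + (z - w i) * poleSum w (Function.update a i 0) 1 z,
    fun z => b i + c i * (z - w i) + (z - w i) ^ 2 *
      (poleSum w (Function.update b i 0) 2 z + poleSum w (Function.update c i 0) 1 z),
    analyticAt_const.fun_add (hlin.fun_mul (analytic a 1)),
    (analyticAt_const.fun_add (analyticAt_const.fun_mul hlin)).fun_add
      ((hlin.fun_pow 2).fun_mul ((analytic b 2).fun_add (analytic c 1))), by simp, by simp, ?_⟩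
  filter_upwards [self_mem_nhdsWithin] with z hz
  have := sub_ne_zero.2 hz
  rw [Pi.add_apply, poleSum_eq_add_update w a 1 i, poleSum_eq_add_update w b 2 i,
    poleSum_eq_add_update w c 1 i]
  constructor <;> field_simp
  ring

variable {a b}

theorem hasExponents_poleSum (hw : Function.Injective w) {i : ι} {s₁ s₂ : ℂ}
    (hadd : s₁ + s₂ = 1 - a i) (hmul : s₁ * s₂ = b i) :
    HasExponents (poleSum w a 1) (poleSum w b 2 + poleSum w c 1) (w i) s₁ s₂ :=
  ⟨a i, b i, hasRegularForm_poleSum a b c hw i, fun s => by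
    rw [← hmul]; linear_combination s * hadd⟩

theorem HasRegularForm.not_isOrdinaryPoint {p q : ℂ → ℂ} {x α β : ℂ}
    (h : HasRegularForm p q x α β) (hα : α ≠ 0) : ¬ IsOrdinaryPoint p q x := by
  obtain ⟨f, g, hf, -, rfl, -, hfg⟩ := h
  rintro ⟨F, G, hF, -, hFG⟩
  have hzero : Tendsto (fun z => (z - x) * F z) (𝓝[≠] x) (𝓝 0) := by
    have : ContinuousAt (fun z => (z - x) * F z) x :=
      (continuousAt_id.sub continuousAt_const).mul hF.continuousAt
    simpa using this.tendsto.mono_left nhdsWithin_le_nhds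
  have hf_lim : Tendsto f (𝓝[≠] x) (𝓝 (f x)) :=
    hf.continuousAt.tendsto.mono_left nhdsWithin_le_nhds
  refine hα (tendsto_nhds_unique (hf_lim.congr' ?_) hzero)
  filter_upwards [hfg, hFG, self_mem_nhdsWithin] with z hz hz' hne
  rw [← hz'.1, hz.1, mul_div_cancel₀ _ (sub_ne_zero.2 hne)]

theorem isRegularSingularPoint_poleSum (hw : Function.Injective w) {i : ι} (hi : a i ≠ 0) :
    IsRegularSingularPoint (poleSum w a 1) (poleSum w b 2 + poleSum w c 1) (w i) :=
  have h := hasRegularForm_poleSum a b c hw i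
  ⟨h.not_isOrdinaryPoint hi, _, _, h⟩

theorem HasRegularForm.isOrdinaryPoint_or_isRegularSingularPoint {p q : ℂ → ℂ} {x α β : ℂ}
    (h : HasRegularForm p q x α β) : IsOrdinaryPoint p q x ∨ IsRegularSingularPoint p q x :=
  or_iff_not_imp_left.2 fun hord => ⟨hord, α, β, h⟩

variable (w a b) {c}

theorem hasRegularForm_poleSum_inv (hc : ∑ i, c i = 0) :
    HasRegularForm (fun t => 2 / t - poleSum w a 1 t⁻¹ / t ^ 2)
      (fun t => (poleSum w b 2 + poleSum w c 1) t⁻¹ / t ^ 4) 0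
      (2 - ∑ i, a i) (∑ i, b i + ∑ i, c i * w i) := by
  have analytic (a : ι → ℂ) (k : ℕ) : AnalyticAt ℂ (fun t => ∑ i, a i / (1 - w i * t) ^ k) 0 := by
    refine Finset.analyticAt_fun_sum _ fun i _ => analyticAt_const.fun_div ?_ (by simp)
    exact (analyticAt_const.fun_sub (analyticAt_const.fun_mul analyticAt_id)).fun_pow k
  refine ⟨fun t => 2 - ∑ i, a i / (1 - w i * t) ^ 1, fun t => ∑ i, b i / (1 - w i * t) ^ 2 +
    ∑ i, c i * w i / (1 - w i * t) ^ 1, analyticAt_const.fun_sub (analytic a 1),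
    (analytic b 2).fun_add (analytic (c * w) 1), by simp, by simp, ?_⟩
  have hwt : ∀ᶠ t in 𝓝[≠] (0 : ℂ), ∀ i, 1 - w i * t ≠ 0 := by
    refine eventually_all.2 fun i => Filter.Eventually.filter_mono nhdsWithin_le_nhds ?_
    exact ContinuousAt.eventually_ne (by fun_prop) (by simp)
  filter_upwards [hwt, self_mem_nhdsWithin] with t ht ht₀
  have ht₀ : t ≠ 0 := ht₀
  rw [Pi.add_apply, poleSum_inv w a 1 ht₀, poleSum_inv w b 2 ht₀,
    poleSum_inv_of_sum_eq_zero w hc ht₀ ht]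
  simp only [pow_one, sub_zero]
  constructor <;> field_simp

variable {w}

theorem isFuchsian_poleSum (hw : Function.Injective w) (hc : ∑ i, c i = 0) :
    IsFuchsian (poleSum w a 1) (poleSum w b 2 + poleSum w c 1) := by
  refine ⟨fun x => ?_,
    (hasRegularForm_poleSum_inv w a b hc).isOrdinaryPoint_or_isRegularSingularPoint⟩
  by_cases hx : ∃ i, w i = x
  · obtain ⟨i, rfl⟩ := hx
    exact (hasRegularForm_poleSum a b c hw i).isOrdinaryPoint_or_isRegularSingularPoint
  · exact .inl (isOrdinaryPoint_poleSum w a b c fun i hi => hx ⟨i, hi.symm⟩)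

end PoleSumCoefficients

section FHomotopy

variable {𝕜 ι : Type*} [RCLike 𝕜] [NormedAlgebra 𝕜 ℂ] [Fintype ι]

theorem isSolutionOn_fHomotopy_iff {w : ι → ℂ} (hw : Function.Injective w) (a b c ν : ι → ℂ)
    {U : Set 𝕜} (hU : IsOpen U) (hUw : ∀ x ∈ U, ∀ i, algebraMap 𝕜 ℂ x ≠ w i) {E y : 𝕜 → ℂ}
    (hE₀ : ∀ x ∈ U, E x ≠ 0)
    (hE : ∀ x ∈ U, HasDerivAt E (poleSum w ν 1 (algebraMap 𝕜 ℂ x) * E x) x) :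
    IsSolutionOn 1 (poleSum w a 1) (poleSum w b 2 + poleSum w c 1) U (E * y) ↔
      IsSolutionOn 1 (poleSum w (a + (2 : ℂ) • ν) 1)
        (poleSum w (b + (a + ν) * ν - ν) 2 + poleSum w (c + crossResidue w (a + ν) ν) 1) U y := by
  rw [isSolutionOn_mul_iff (s' := -poleSum w ν 2) hU hE₀ hE
    fun x hx => hasDerivAt_poleSum ν (hUw x hx)]
  refine isSolutionOn_iff_div (fun _ _ => one_ne_zero) (fun x _ => ?_) fun x hx => ?_
  · simp only [div_one, Pi.add_apply, Pi.mul_apply, Pi.ofNat_apply, poleSum_add, poleSum_smul]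
  · have hmul := poleSum_mul hw (a + ν) ν (hUw x hx)
    simp only [Pi.one_apply, div_one, Pi.add_apply, Pi.mul_apply, Pi.pow_apply, Pi.neg_apply,
      poleSum_add, poleSum_sub] at hmul ⊢
    linear_combination hmul

theorem hasDerivAt_logBranch {ℓ : 𝕜 → ℂ} {z : ℂ} {x : 𝕜} (hℓ : DifferentiableAt 𝕜 ℓ x)
    (hexp : ∀ᶠ t in 𝓝 x, Complex.exp (ℓ t) = algebraMap 𝕜 ℂ t - z) :
    HasDerivAt ℓ (algebraMap 𝕜 ℂ x - z)⁻¹ x := by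
  have hexp_deriv : HasDerivAt (fun t => algebraMap 𝕜 ℂ t - z)
      (Complex.exp (ℓ x) * deriv ℓ x) x :=
    hℓ.hasDerivAt.cexp.congr_of_eventuallyEq (hexp.mono fun _ => Eq.symm)
  have hmul := hexp_deriv.unique ((hasDerivAt_algebraMap x).sub_const z)
  rw [hexp.self_of_nhds] at hmul
  rw [← eq_inv_of_mul_eq_one_right hmul]
  exact hℓ.hasDerivAt

theorem hasDerivAt_prod_exp_logBranch {z : ι → ℂ} (ν : ι → ℂ) {ℓ : ι → 𝕜 → ℂ} {x : 𝕜}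
    (hℓ : ∀ i, DifferentiableAt 𝕜 (ℓ i) x)
    (hexp : ∀ i, ∀ᶠ t in 𝓝 x, Complex.exp (ℓ i t) = algebraMap 𝕜 ℂ t - z i) :
    HasDerivAt (fun t => ∏ i, Complex.exp (ν i * ℓ i t))
      (poleSum z ν 1 (algebraMap 𝕜 ℂ x) * ∏ i, Complex.exp (ν i * ℓ i x)) x := by
  simp only [← Complex.exp_sum, poleSum, pow_one, div_eq_mul_inv]
  rw [mul_comm]
  exact (HasDerivAt.fun_sum fun i _ =>
    (hasDerivAt_logBranch (hℓ i) (hexp i)).const_mul (ν i)).cexp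

end FHomotopy

namespace KNdS

section Radial

open Polynomial HasSimpleRoots

/-- `Δ_r` as a polynomial in `r`. -/
noncomputable def deltaPoly (P : KNdS) : ℂ[X] :=
  (1 - C (P.Λ / 3 : ℂ) * X ^ 2) * (X ^ 2 + C (P.a ^ 2 : ℂ)) - C (2 * P.M : ℂ) * X + C (P.e ^ 2 : ℂ)

/-- `K` as a polynomial in `r`. -/
noncomputable def kPoly (P : KNdS) : ℂ[X] :=
  C P.Xi * ((X ^ 2 + C (P.a ^ 2 : ℂ)) * C P.ω - C (P.m * P.a : ℂ)) + C (P.e * P.q : ℂ) * X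

/-- The terms of `-radialC` without a denominator, as a polynomial in `r`. -/
noncomputable def massPoly (P : KNdS) : ℂ[X] :=
  C (2 * Complex.I * P.ω * P.Xi) * X + C (Complex.I * P.e * P.q) + C (P.μ ^ 2 : ℂ) * X ^ 2
    + C (P.lam ^ 2)

variable (P : KNdS)

theorem eval_deltaPoly (r : ℂ) : P.deltaPoly.eval r = P.Delta r := by
  simp [Delta, deltaPoly]

theorem eval_kPoly (r : ℂ) : P.kPoly.eval r = P.K r := by
  simp [K, kPoly]

theorem eval_massPoly (r : ℂ) : P.massPoly.eval r =
    2 * Complex.I * P.ω * P.Xi * r + Complex.I * P.e * P.q + P.μ ^ 2 * r ^ 2 + P.lam ^ 2 := by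
  simp [massPoly]

theorem deriv_Delta : deriv P.Delta = fun r => (derivative P.deltaPoly).eval r := by
  rw [← funext P.eval_deltaPoly]
  exact funext fun r => Polynomial.deriv _

theorem deriv_deriv_Delta :
    deriv (deriv P.Delta) = fun r => (derivative (derivative P.deltaPoly)).eval r := by
  rw [deriv_Delta]
  exact funext fun r => Polynomial.deriv _

theorem deriv_K : deriv P.K = fun r => (derivative P.kPoly).eval r := by
  rw [← funext P.eval_kPoly]
  exact funext fun r => Polynomial.deriv _

theorem deltaPoly_eq : P.deltaPoly = C (-P.Λ / 3 : ℂ) * X ^ 4 +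
    (C (1 - P.Λ / 3 * P.a ^ 2 : ℂ) * X ^ 2 + C (-2 * P.M : ℂ) * X +
      C (P.a ^ 2 + P.e ^ 2 : ℂ)) := by
  refine Polynomial.funext fun r => ?_
  simp only [deltaPoly, eval_add, eval_sub, eval_mul, eval_pow, eval_X, eval_C, eval_one]
  ring

variable {P}

theorem degree_deltaPoly (hΛ : P.Λ ≠ 0) : P.deltaPoly.degree = 4 := by
  rw [deltaPoly_eq]
  compute_degree!

theorem leadingCoeff_deltaPoly (hΛ : P.Λ ≠ 0) : P.deltaPoly.leadingCoeff = -P.Λ / 3 := by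
  rw [leadingCoeff, natDegree_eq_of_degree_eq_some (degree_deltaPoly hΛ), deltaPoly_eq]
  simp only [coeff_add, coeff_C_mul, coeff_X_pow, coeff_X, coeff_C]
  norm_num

theorem hasSimpleRoots_deltaPoly {v : Fin 4 → ℂ} (hΛ : P.Λ ≠ 0)
    (hroot : ∀ i, P.Delta (v i) = 0) (hv : Function.Injective v) :
    HasSimpleRoots P.deltaPoly v where
  injective := hv
  degree_eq := degree_deltaPoly hΛ
  eval_eq_zero i := (P.eval_deltaPoly (v i)).trans (hroot i)

theorem degree_kPoly_lt : P.kPoly.degree < Fintype.card (Fin 4) := by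
  have : P.kPoly.degree ≤ 2 := by unfold kPoly; compute_degree
  exact this.trans_lt (by decide)

theorem degree_massPoly_le : P.massPoly.degree ≤ 2 := by
  unfold massPoly; compute_degree

theorem degree_massPoly_lt : P.massPoly.degree < Fintype.card (Fin 4) :=
  degree_massPoly_le.trans_lt (by decide)

theorem lam_add_eq (hμ : P.μ ≠ 0) (r : ℂ) :
    P.lam + Complex.I * P.μ * r = Complex.I * P.μ * (r - P.r₅) := by
  have : (P.μ : ℂ) ≠ 0 := Complex.ofReal_ne_zero.2 hμ
  rw [r₅]
  field_simp
  linear_combination P.lam * Complex.I_sq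

theorem massTerm_eq (hμ : P.μ ≠ 0) (r : ℂ) :
    P.μ * P.K r / (P.lam + Complex.I * P.μ * r) = -Complex.I * (P.K r / (r - P.r₅)) := by
  have : (P.μ : ℂ) ≠ 0 := Complex.ofReal_ne_zero.2 hμ
  rw [lam_add_eq hμ, mul_comm Complex.I, mul_assoc, mul_div_mul_left _ _ this,
    div_mul_eq_div_div_swap, div_eq_mul_inv _ Complex.I, Complex.inv_I]
  ring

/-- The residues of the coefficient of the first derivative: `none` stands for the fifth point, the
zero of `λ + i μ r`, and `some i` for the zeros of `Δ_r`. -/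
noncomputable def firstOrderResidue : Option (Fin 4) → ℂ := Option.elim' (-1) fun _ => 1 / 2

variable {v : Fin 4 → ℂ} {r : ℂ}

theorem K_div_Delta (h : HasSimpleRoots P.deltaPoly v) (hr : ∀ i, r ≠ v i) :
    P.K r / P.Delta r = poleSum v (residue P.kPoly P.deltaPoly v) 1 r := by
  rw [← h.eval_div_eval degree_kPoly_lt hr, ← eval_kPoly, ← eval_deltaPoly]

theorem deriv_Delta_div_Delta (h : HasSimpleRoots P.deltaPoly v) (hr : ∀ i, r ≠ v i) :
    deriv P.Delta r / P.Delta r = poleSum v 1 1 r := by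
  rw [← h.residue_derivative, ← h.eval_div_eval h.degree_derivative_lt hr, deriv_Delta,
    ← eval_deltaPoly]

theorem Delta_ne_zero (h : HasSimpleRoots P.deltaPoly v) (hr : ∀ i, r ≠ v i) : P.Delta r ≠ 0 := by
  rw [← eval_deltaPoly]
  exact h.eval_ne_zero hr

theorem radialB_div_Delta (hμ : P.μ ≠ 0) (h : HasSimpleRoots P.deltaPoly v)
    (hr : ∀ i, r ≠ v i) :
    P.radialB r / P.Delta r = poleSum (Option.elim' P.r₅ v) firstOrderResidue 1 r := by
  have hΔ := Delta_ne_zero h hr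
  have hIμ : Complex.I * P.μ ≠ 0 := mul_ne_zero Complex.I_ne_zero (Complex.ofReal_ne_zero.2 hμ)
  have hhalf : poleSum v (fun _ => 1 / 2) 1 r = 1 / 2 * (deriv P.Delta r / P.Delta r) := by
    rw [deriv_Delta_div_Delta h hr, ← poleSum_smul]
    congr 1
    funext i
    simp
  rw [firstOrderResidue, poleSum_elim', hhalf, radialB, lam_add_eq hμ,
    sub_div, mul_div_assoc', mul_div_mul_left _ _ hIμ, div_div_cancel_left' hΔ]
  ring

/-- The residues of `radialC / Δ_r`, with the same indexing as `firstOrderResidue`. Up to the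
polynomial terms, `radialC / Δ_r` is the product of `K / Δ_r` and
`K / Δ_r + i Δ_r' / (2 Δ_r) + i / (r - r₅)`. -/
noncomputable def radialResidue (P : KNdS) (v : Fin 4 → ℂ) : Option (Fin 4) → ℂ :=
  crossResidue (Option.elim' P.r₅ v) (Option.elim' 0 (residue P.kPoly P.deltaPoly v))
      (Option.elim' Complex.I (residue P.kPoly P.deltaPoly v + (Complex.I / 2) • 1))
    - Option.elim' 0 (residue P.massPoly P.deltaPoly v)

theorem residue_kPoly (P : KNdS) (v : Fin 4 → ℂ) (i : Fin 4) :
    residue P.kPoly P.deltaPoly v i = P.K (v i) / deriv P.Delta (v i) := by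
  rw [residue, deriv_Delta, ← eval_kPoly]

theorem residue_kPoly_mul (P : KNdS) (v : Fin 4 → ℂ) (i : Fin 4) :
    residue P.kPoly P.deltaPoly v i * (residue P.kPoly P.deltaPoly v i + Complex.I / 2) =
      P.Q (v i) := by
  rw [residue_kPoly, Q]
  ring

theorem radialC_div_Delta (hμ : P.μ ≠ 0) (h : HasSimpleRoots P.deltaPoly v)
    (h₅ : ∀ i, P.r₅ ≠ v i) (hr : ∀ i, r ≠ v i) (hr₅ : r ≠ P.r₅) :
    P.radialC r / P.Delta r =
      poleSum (Option.elim' P.r₅ v) (Option.elim' 0 (P.Q ∘ v)) 2 r +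
        poleSum (Option.elim' P.r₅ v) (radialResidue P v) 1 r := by
  have hΔ := Delta_ne_zero h hr
  have hK := K_div_Delta h hr
  have hΔ' := deriv_Delta_div_Delta h hr
  have hmass : P.massPoly.eval r / P.Delta r =
      poleSum v (residue P.massPoly P.deltaPoly v) 1 r := by
    rw [← h.eval_div_eval degree_massPoly_lt hr, ← eval_deltaPoly]
  have hQ : Option.elim' 0 (residue P.kPoly P.deltaPoly v) *
      Option.elim' Complex.I (residue P.kPoly P.deltaPoly v + (Complex.I / 2) • 1) =
        Option.elim' 0 (P.Q ∘ v) := by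
    funext i
    cases i <;> simp [← residue_kPoly_mul]
  have hfactor : P.radialC r / P.Delta r =
      P.K r / P.Delta r * (Complex.I / (r - P.r₅) + (P.K r / P.Delta r +
        Complex.I / 2 * (deriv P.Delta r / P.Delta r))) - P.massPoly.eval r / P.Delta r := by
    rw [radialC, massTerm_eq hμ, eval_massPoly]
    field_simp
    ring
  have hmul := poleSum_mul (optionElim'_injective h.injective h₅)
    (Option.elim' 0 (residue P.kPoly P.deltaPoly v))
    (Option.elim' Complex.I (residue P.kPoly P.deltaPoly v + (Complex.I / 2) • 1))
    (Option.forall.2 ⟨hr₅, hr⟩)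
  simp only [hQ, poleSum_elim', poleSum_add, poleSum_smul, pow_one, zero_div, zero_add, ← hK,
    ← hΔ'] at hmul
  rw [hfactor, hmul, radialResidue]
  simp only [poleSum_sub, poleSum_elim', hmass]
  ring

theorem L_eq (hμ : P.μ ≠ 0) (h : HasSimpleRoots P.deltaPoly v) (rp rm : ℝ) (i : Fin 4) :
    P.L rp rm (v i) = (rm - rp) * radialResidue P v (some i) := by
  have hΔ' : deriv P.Delta (v i) ≠ 0 := by
    rw [deriv_Delta]
    exact h.eval_derivative_ne_zero i
  have hsum_K : ∑ j, residue P.kPoly P.deltaPoly v j / (v i - v j) =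
      deriv P.K (v i) / deriv P.Delta (v i) -
        P.K (v i) * deriv (deriv P.Delta) (v i) / (2 * deriv P.Delta (v i) ^ 2) := by
    rw [h.sum_residue_div degree_kPoly_lt, deriv_deriv_Delta, deriv_Delta, deriv_K, ← eval_kPoly]
  have hsum_one : ∑ j, 1 / (v i - v j) =
      deriv (deriv P.Delta) (v i) / (2 * deriv P.Delta (v i)) := by
    rw [h.sum_one_div_sub, deriv_deriv_Delta, deriv_Delta]
  have hmass : residue P.massPoly P.deltaPoly v i =
      P.massPoly.eval (v i) / deriv P.Delta (v i) := by
    rw [residue, deriv_Delta]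
  rw [radialResidue, Pi.sub_apply, crossResidue_elim'_some, Option.elim'_some,
    crossResidue_add_smul_one, hsum_K, hsum_one, hmass, residue_kPoly, L, massTerm_eq hμ,
    eval_massPoly]
  field_simp
  ring

theorem L₅_eq (h : HasSimpleRoots P.deltaPoly v) (h₅ : ∀ i, P.r₅ ≠ v i) (rp rm : ℝ) :
    P.L₅ rp rm = (rm - rp) * radialResidue P v none := by
  have hK : P.K P.r₅ / P.Delta P.r₅ =
      ∑ i, residue P.kPoly P.deltaPoly v i / (P.r₅ - v i) := by
    simpa only [poleSum, pow_one] using K_div_Delta h h₅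
  rw [radialResidue, Pi.sub_apply, crossResidue_elim'_none, Option.elim'_none, L₅, mul_div_assoc,
    hK]
  simp only [zero_mul, zero_add, mul_div_right_comm, ← Finset.sum_mul]
  ring

theorem elim'_L (hμ : P.μ ≠ 0) (h : HasSimpleRoots P.deltaPoly v) (h₅ : ∀ i, P.r₅ ≠ v i)
    (rp rm : ℝ) :
    Option.elim' (P.L₅ rp rm) (P.L rp rm ∘ v) = (rm - rp : ℂ) • radialResidue P v := by
  funext i
  cases i
  exacts [L₅_eq h h₅ rp rm, L_eq hμ h rp rm _]

theorem sum_radialResidue (h : HasSimpleRoots P.deltaPoly v) : ∑ i, radialResidue P v i = 0 := by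
  have hmass : P.massPoly.coeff 3 = 0 :=
    coeff_eq_zero_of_degree_lt (degree_massPoly_le.trans_lt (by decide))
  simp only [radialResidue, Pi.sub_apply, Finset.sum_sub_distrib, sum_crossResidue,
    Fintype.sum_option, Option.elim'_none, Option.elim'_some, h.sum_residue degree_massPoly_lt,
    Fintype.card_fin, hmass, zero_div, add_zero, sub_zero]

theorem L₅_add_sum_L (hμ : P.μ ≠ 0) (h : HasSimpleRoots P.deltaPoly v) (h₅ : ∀ i, P.r₅ ≠ v i)
    (rp rm : ℝ) : P.L₅ rp rm + ∑ i, P.L rp rm (v i) = 0 := by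
  have hsum := sum_radialResidue h
  rw [Fintype.sum_option] at hsum
  simp only [L₅_eq h h₅, L_eq hμ h, ← Finset.mul_sum, ← mul_add, hsum, mul_zero]

end Radial

section Coefficients

variable (z Q L ν : Fin 4 → ℂ) (z₅ L₅ : ℂ)

theorem preB_eq : preB z z₅ = poleSum (Option.elim' z₅ z) firstOrderResidue 1 := by
  funext x
  rw [firstOrderResidue, poleSum_elim', poleSum]
  simp only [preB, pow_one, Finset.mul_sum, mul_one_div]
  ring

theorem preC_eq : preC z Q L z₅ L₅ =
    poleSum (Option.elim' z₅ z) (Option.elim' 0 Q) 2 +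
      poleSum (Option.elim' z₅ z) (Option.elim' L₅ L) 1 := by
  funext x
  rw [Pi.add_apply, poleSum_elim', poleSum_elim', poleSum, poleSum]
  simp only [preC, pow_one]
  ring

theorem finalB_eq : finalB z ν z₅ =
    poleSum (Option.elim' z₅ z) (firstOrderResidue + (2 : ℂ) • Option.elim' 0 ν) 1 := by
  funext x
  rw [poleSum_add, poleSum_smul, ← preB_eq, poleSum_elim']
  simp only [finalB, preB, poleSum, pow_one, zero_div, zero_add, Finset.mul_sum]
  rw [sub_add_eq_add_sub, ← Finset.sum_add_distrib]
  congr 1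
  refine Finset.sum_congr rfl fun i _ => ?_
  rw [← div_div]
  ring

theorem firstOrderResidue_add_elim' :
    firstOrderResidue + Option.elim' 0 ν = Option.elim' (-1) fun i => 1 / 2 + ν i := by
  funext i
  cases i <;> simp [firstOrderResidue]

theorem L'_eq (i : Fin 4) : L' z ν L z₅ i = L i +
    crossResidue (Option.elim' z₅ z) (firstOrderResidue + Option.elim' 0 ν)
      (Option.elim' 0 ν) (some i) := by
  have herase : ∑ j ∈ Finset.univ.erase i, (4 * ν i * ν j + ν i + ν j) / (2 * (z i - z j)) =
      crossResidue z (fun i => 1 / 2 + ν i) ν i := by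
    rw [Finset.sum_erase _ (by rw [sub_self, mul_zero, div_zero]), crossResidue]
    exact Finset.sum_congr rfl fun j _ => by rw [← div_div]; ring
  rw [L', herase, firstOrderResidue_add_elim', crossResidue_elim'_some]
  ring

theorem L₅'_eq : L₅' z ν z₅ L₅ = L₅ +
    crossResidue (Option.elim' z₅ z) (firstOrderResidue + Option.elim' 0 ν)
      (Option.elim' 0 ν) none := by
  simp only [L₅', firstOrderResidue_add_elim', crossResidue_elim'_none, mul_zero, add_zero,
    neg_mul, one_mul, neg_div, Finset.sum_neg_distrib, sub_eq_add_neg]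

theorem finalC_eq : finalC z ν L z₅ L₅ = poleSum (Option.elim' z₅ z) 0 2 +
    poleSum (Option.elim' z₅ z) (Option.elim' L₅ L +
      crossResidue (Option.elim' z₅ z) (firstOrderResidue + Option.elim' 0 ν)
        (Option.elim' 0 ν)) 1 := by
  funext x
  simp only [finalC, L'_eq, L₅'_eq, Pi.add_apply, poleSum, Fintype.sum_option, Option.elim'_none,
    Option.elim'_some, pow_one, Pi.zero_apply, zero_div, Finset.sum_const_zero, zero_add]
  ring

end Coefficients

section AffineCoordinate

variable {rp rm : ℝ} {r x : ℂ}

theorem ofReal_sub_ne_zero (hrad : rp ≠ rm) : (rm - rp : ℂ) ≠ 0 :=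
  sub_ne_zero.2 (Complex.ofReal_injective.ne hrad.symm)

theorem eq_zOf_iff (hrad : rp ≠ rm) : x = zOf rp rm r ↔ rp + x * (rm - rp) = r := by
  rw [zOf, eq_div_iff (ofReal_sub_ne_zero hrad), eq_sub_iff_add_eq']

theorem zOf_left (rp rm : ℝ) : zOf rp rm rp = 0 := by
  rw [zOf, sub_self, zero_div]

theorem zOf_right (hrad : rp ≠ rm) : zOf rp rm rm = 1 :=
  div_self (ofReal_sub_ne_zero hrad)

theorem zOf_injective (hrad : rp ≠ rm) : Function.Injective (zOf rp rm) :=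
  fun _ _ h => sub_left_injective ((div_left_inj' (ofReal_sub_ne_zero hrad)).1 h)

theorem poleSum_zOf {ι : Type*} [Fintype ι] (hrad : rp ≠ rm) (v : ι → ℂ) (r : ℂ)
    (a : Option ι → ℂ) (k : ℕ) (x : ℂ) :
    poleSum (Option.elim' (zOf rp rm r) (zOf rp rm ∘ v)) a k x =
      (rm - rp) ^ k * poleSum (Option.elim' r v) a k (rp + x * (rm - rp)) := by
  rw [← poleSum_affine _ _ _ (ofReal_sub_ne_zero hrad)]
  congr 1
  funext i
  cases i <;> rfl

end AffineCoordinate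

section Equations

variable {P : KNdS} {v : Fin 4 → ℂ} {rp rm : ℝ}

theorem Delta_eq_prod (hΛ : P.Λ ≠ 0) (h : HasSimpleRoots P.deltaPoly v) (hrad : rp ≠ rm) (x : ℂ) :
    P.Delta (rp + x * (rm - rp)) =
      -P.Λ / 3 * (rm - rp) ^ 4 * ∏ i, (x - zOf rp rm (v i)) := by
  have hfactor (i : Fin 4) :
      rp + x * (rm - rp) - v i = (rm - rp) * (x - zOf rp rm (v i)) := by
    have := ofReal_sub_ne_zero hrad
    rw [zOf]
    field_simp
    ring
  rw [← eval_deltaPoly, h.eval_eq_prod, leadingCoeff_deltaPoly hΛ]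
  simp only [hfactor, Finset.prod_mul_distrib, Finset.prod_const, Finset.card_univ,
    Fintype.card_fin, mul_assoc]

theorem radialB_div_Delta_affine (hμ : P.μ ≠ 0) (h : HasSimpleRoots P.deltaPoly v)
    (hrad : rp ≠ rm) {x : ℂ} (hx : ∀ i, x ≠ zOf rp rm (v i)) :
    (rm - rp) * P.radialB (rp + x * (rm - rp)) / P.Delta (rp + x * (rm - rp)) =
      preB (zOf rp rm ∘ v) (zOf rp rm P.r₅) x := by
  rw [mul_div_assoc, radialB_div_Delta hμ h fun i hi => hx i ((eq_zOf_iff hrad).2 hi), preB_eq,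
    poleSum_zOf hrad, pow_one]

theorem radialC_div_Delta_affine (hμ : P.μ ≠ 0) (h : HasSimpleRoots P.deltaPoly v)
    (h₅ : ∀ i, P.r₅ ≠ v i) (hrad : rp ≠ rm) {x : ℂ} (hx : ∀ i, x ≠ zOf rp rm (v i))
    (hx₅ : x ≠ zOf rp rm P.r₅) :
    (rm - rp) ^ 2 * P.radialC (rp + x * (rm - rp)) / P.Delta (rp + x * (rm - rp)) =
      preC (zOf rp rm ∘ v) (P.Q ∘ v) (P.L rp rm ∘ v) (zOf rp rm P.r₅) (P.L₅ rp rm) x := by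
  rw [mul_div_assoc, radialC_div_Delta hμ h h₅ (fun i hi => hx i ((eq_zOf_iff hrad).2 hi))
    fun hi => hx₅ ((eq_zOf_iff hrad).2 hi), preC_eq, elim'_L hμ h h₅, Pi.add_apply, poleSum_smul,
    poleSum_zOf hrad, poleSum_zOf hrad]
  ring

variable {𝕜 : Type*} [RCLike 𝕜] [NormedAlgebra 𝕜 ℂ] {U : Set 𝕜}

theorem isSolutionOn_radial_iff [IsScalarTower ℝ 𝕜 ℂ] (hμ : P.μ ≠ 0)
    (h : HasSimpleRoots P.deltaPoly v) (h₅ : ∀ i, P.r₅ ≠ v i) (hrad : rp ≠ rm) (hU : IsOpen U)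
    (hUz : ∀ x ∈ U, (∀ i, algebraMap 𝕜 ℂ x ≠ zOf rp rm (v i)) ∧
      algebraMap 𝕜 ℂ x ≠ zOf rp rm P.r₅)
    {R Rz : 𝕜 → ℂ} (hR : ∀ x ∈ U, Rz x =
      R (algebraMap ℝ 𝕜 rp + x * (algebraMap ℝ 𝕜 rm - algebraMap ℝ 𝕜 rp))) :
    IsSolutionOn P.Delta P.radialB P.radialC
        ((fun x => algebraMap ℝ 𝕜 rp + x * (algebraMap ℝ 𝕜 rm - algebraMap ℝ 𝕜 rp)) '' U) R ↔
      IsSolutionOn 1 (preB (zOf rp rm ∘ v) (zOf rp rm P.r₅))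
        (preC (zOf rp rm ∘ v) (P.Q ∘ v) (P.L rp rm ∘ v) (zOf rp rm P.r₅) (P.L₅ rp rm)) U Rz := by
  have coe (t : ℝ) : algebraMap 𝕜 ℂ (algebraMap ℝ 𝕜 t) = t :=
    (IsScalarTower.algebraMap_apply ℝ 𝕜 ℂ t).symm
  have hc : algebraMap ℝ 𝕜 rm - algebraMap ℝ 𝕜 rp ≠ 0 :=
    sub_ne_zero.2 ((algebraMap ℝ 𝕜).injective.ne hrad.symm)
  rw [isSolutionOn_image_affine_iff hc, isSolutionOn_congr hU hR]
  simp only [map_sub, coe]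
  refine isSolutionOn_iff_div (fun x hx => ?_)
    (fun x hx => radialB_div_Delta_affine hμ h hrad (hUz x hx).1)
    (fun x hx => radialC_div_Delta_affine hμ h h₅ hrad (hUz x hx).1 (hUz x hx).2)
  exact Delta_ne_zero h fun i hi => (hUz x hx).1 i ((eq_zOf_iff hrad).2 hi)

theorem isSolutionOn_preB_iff_finalB {z Q L ν : Fin 4 → ℂ} {z₅ L₅ : ℂ}
    (hz : Function.Injective z) (hz₅ : ∀ i, z₅ ≠ z i)
    (hν : ∀ i, ν i * (ν i - 1) + 1 / 2 * ν i + Q i = 0) (hU : IsOpen U)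
    (hUz : ∀ x ∈ U, (∀ i, algebraMap 𝕜 ℂ x ≠ z i) ∧ algebraMap 𝕜 ℂ x ≠ z₅)
    {ℓ : Fin 4 → 𝕜 → ℂ} (hℓ : ∀ i, DifferentiableOn 𝕜 (ℓ i) U)
    (hexp : ∀ i, ∀ x ∈ U, Complex.exp (ℓ i x) = algebraMap 𝕜 ℂ x - z i) {y : 𝕜 → ℂ} :
    IsSolutionOn 1 (preB z z₅) (preC z Q L z₅ L₅) U
        (fun x => (∏ i, Complex.exp (ν i * ℓ i x)) * y x) ↔
      IsSolutionOn 1 (finalB z ν z₅) (finalC z ν L z₅ L₅) U y := by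
  have hdouble : Option.elim' 0 Q + (firstOrderResidue + Option.elim' 0 ν) * Option.elim' 0 ν -
      Option.elim' 0 ν = 0 := by
    funext i
    cases i with
    | none => simp
    | some i =>
      simp only [firstOrderResidue, Pi.add_apply, Pi.sub_apply, Pi.mul_apply, Pi.zero_apply,
        Option.elim'_some]
      linear_combination hν i
  rw [preB_eq, preC_eq, finalB_eq, finalC_eq, ← hdouble]
  refine isSolutionOn_fHomotopy_iff (optionElim'_injective hz hz₅) _ _ _ _ hU
    (fun x hx => Option.forall.2 ⟨(hUz x hx).2, (hUz x hx).1⟩)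
    (fun x _ => Finset.prod_ne_zero_iff.2 fun i _ => Complex.exp_ne_zero _) fun x hx => ?_
  have hE := hasDerivAt_prod_exp_logBranch (z := z) ν
    (fun i => (hℓ i).differentiableAt (hU.mem_nhds hx))
    (fun i => eventually_of_mem (hU.mem_nhds hx) (hexp i))
  rwa [poleSum_elim', zero_div, zero_add]

end Equations

section Exponents

variable {P : KNdS} {r ν : ℂ}

theorem exponent_eq_or (hν : ν * (ν - 1) + 1 / 2 * ν + P.Q r = 0) :
    ν = Complex.I * (P.K r / deriv P.Delta r) ∨
      ν = 1 / 2 - Complex.I * (P.K r / deriv P.Delta r) := by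
  have hfactor : (ν - Complex.I * (P.K r / deriv P.Delta r)) *
      (ν - (1 / 2 - Complex.I * (P.K r / deriv P.Delta r))) = 0 := by
    rw [Q] at hν
    linear_combination hν - (P.K r / deriv P.Delta r) ^ 2 * Complex.I_sq
  simpa only [mul_eq_zero, sub_eq_zero] using hfactor

theorem im_K_div_deriv_Delta (hω : P.ω.im = 0) (hr : r.im = 0) :
    (P.K r / deriv P.Delta r).im = 0 := by
  rw [← Complex.conj_eq_iff_im] at *
  have hK : starRingEnd ℂ (P.K r) = P.K r := by simp [K, Xi, hω, hr, map_ofNat]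
  have hΔ' : starRingEnd ℂ (deriv P.Delta r) = deriv P.Delta r := by
    simp [deriv_Delta, deltaPoly_eq, Polynomial.derivative_pow, hr, map_ofNat]
  rw [map_div₀, hK, hΔ']

theorem exponent_ne_neg_quarter (hω : P.ω.im = 0) (hr : r.im = 0)
    (hν : ν * (ν - 1) + 1 / 2 * ν + P.Q r = 0) : ν ≠ -1 / 4 := by
  have him := im_K_div_deriv_Delta hω hr
  rintro rfl
  rcases exponent_eq_or hν with h | h <;>
    · have hre := congrArg Complex.re h
      norm_num [him] at hre

end Exponents

section SingularPoints

theorem isOrdinaryPoint_finalB_finalC (z ν L : Fin 4 → ℂ) (z₅ L₅ : ℂ) {x : ℂ}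
    (hx : ∀ i, x ≠ z i) (hx₅ : x ≠ z₅) :
    IsOrdinaryPoint (finalB z ν z₅) (finalC z ν L z₅ L₅) x := by
  rw [finalB_eq, finalC_eq]
  exact isOrdinaryPoint_poleSum _ _ _ _ (Option.forall.2 ⟨hx₅, hx⟩)

variable {z : Fin 4 → ℂ} {z₅ : ℂ} (hz : Function.Injective z) (hz₅ : ∀ i, z₅ ≠ z i)

include hz hz₅

theorem hasExponents_preB_preC (Q L ν : Fin 4 → ℂ) (L₅ : ℂ) {i : Fin 4}
    (hν : ν i * (ν i - 1) + 1 / 2 * ν i + Q i = 0) :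
    HasExponents (preB z z₅) (preC z Q L z₅ L₅) (z i) (ν i) (1 / 2 - ν i) := by
  rw [preB_eq, preC_eq]
  refine hasExponents_poleSum _ (optionElim'_injective hz hz₅) (i := some i) ?_ ?_
  · rw [firstOrderResidue, Option.elim'_some]
    ring
  · rw [Option.elim'_some]
    linear_combination -hν

theorem hasExponents_preB_preC₅ (Q L : Fin 4 → ℂ) (L₅ : ℂ) :
    HasExponents (preB z z₅) (preC z Q L z₅ L₅) z₅ 0 2 := by
  rw [preB_eq, preC_eq]
  exact hasExponents_poleSum _ (optionElim'_injective hz hz₅) (i := none)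
    (by norm_num [firstOrderResidue]) (zero_mul _)

variable (ν L : Fin 4 → ℂ) (L₅ : ℂ)

theorem hasExponents_finalB_finalC (i : Fin 4) :
    HasExponents (finalB z ν z₅) (finalC z ν L z₅ L₅) (z i) 0 (1 / 2 - 2 * ν i) := by
  rw [finalB_eq, finalC_eq]
  refine hasExponents_poleSum _ (optionElim'_injective hz hz₅) (i := some i) ?_ (zero_mul _)
  simp only [firstOrderResidue, Pi.add_apply, Pi.smul_apply, Option.elim'_some, smul_eq_mul]
  ring

theorem hasExponents_finalB_finalC₅ :
    HasExponents (finalB z ν z₅) (finalC z ν L z₅ L₅) z₅ 0 2 := by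
  rw [finalB_eq, finalC_eq]
  exact hasExponents_poleSum _ (optionElim'_injective hz hz₅) (i := none)
    (by norm_num [firstOrderResidue]) (zero_mul _)

theorem isRegularSingularPoint_finalB_finalC {i : Fin 4} (hi : ν i ≠ -1 / 4) :
    IsRegularSingularPoint (finalB z ν z₅) (finalC z ν L z₅ L₅) (z i) := by
  rw [finalB_eq, finalC_eq]
  refine isRegularSingularPoint_poleSum _ (optionElim'_injective hz hz₅) (i := some i)
    fun h => hi ?_
  simp only [firstOrderResidue, Pi.add_apply, Pi.smul_apply, Option.elim'_some,
    smul_eq_mul] at h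
  linear_combination h / 2

theorem isRegularSingularPoint_finalB_finalC₅ :
    IsRegularSingularPoint (finalB z ν z₅) (finalC z ν L z₅ L₅) z₅ := by
  rw [finalB_eq, finalC_eq]
  exact isRegularSingularPoint_poleSum _ (optionElim'_injective hz hz₅) (i := none)
    (by simp [firstOrderResidue])

theorem isFuchsian_finalB_finalC (hL : L₅ + ∑ i, L i = 0) :
    IsFuchsian (finalB z ν z₅) (finalC z ν L z₅ L₅) := by
  rw [finalB_eq, finalC_eq]
  refine isFuchsian_poleSum _ _ (optionElim'_injective hz hz₅) ?_
  simpa only [Pi.add_apply, Finset.sum_add_distrib, sum_crossResidue, add_zero,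
    Fintype.sum_option, Option.elim'_none, Option.elim'_some] using hL

end SingularPoints

end KNdS

theorem mainTheorem3
    (P : KNdS) (hΛ : P.Λ ≠ 0) (hμ : P.μ ≠ 0)
    -- the four zeros of `Δ_r` are distinct, and `r₅` is none of them
    (rp rm : ℝ) (r₃ r₄ : ℂ)
    (hroot : ∀ i, P.Delta (KNdS.radius rp rm r₃ r₄ i) = 0)
    (hinj : Function.Injective (KNdS.radius rp rm r₃ r₄))
    (h₅ : ∀ i, P.r₅ ≠ KNdS.radius rp rm r₃ r₄ i)
    -- the five points and the coefficients
    (z Q L : Fin 4 → ℂ) (z₅ L₅ : ℂ)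
    (hz : ∀ i, z i = KNdS.zOf rp rm (KNdS.radius rp rm r₃ r₄ i))
    (hz₅ : z₅ = KNdS.zOf rp rm P.r₅)
    (hQ : ∀ i, Q i = P.Q (KNdS.radius rp rm r₃ r₄ i))
    (hL : ∀ i, L i = P.L rp rm (KNdS.radius rp rm r₃ r₄ i))
    (hL₅ : L₅ = P.L₅ rp rm)
    -- `ν i` is either root of the indicial equation at `z i`
    (ν : Fin 4 → ℂ) (hν : ∀ i, ν i * (ν i - 1) + 1 / 2 * ν i + Q i = 0) :
    -- the points are `0, 1, z₃, z₄, z₅`, all distinct, and `Δ_r` factorises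
    (z 0 = 0 ∧ z 1 = 1 ∧ Function.Injective z ∧ ∀ i, z₅ ≠ z i) ∧
    (∀ x : ℂ, P.Delta (rp + x * (rm - rp)) = -P.Λ / 3 * (rm - rp) ^ 4 * ∏ i, (x - z i)) ∧
    -- the change of independent variable, for real and for complex `r`
    (∀ {𝕜 : Type} [RCLike 𝕜] [NormedAlgebra 𝕜 ℂ] [IsScalarTower ℝ 𝕜 ℂ] (U : Set 𝕜), IsOpen U →
      (∀ x ∈ U, (∀ i, algebraMap 𝕜 ℂ x ≠ z i) ∧ algebraMap 𝕜 ℂ x ≠ z₅) →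
      ∀ R Rz : 𝕜 → ℂ,
      (∀ x ∈ U, Rz x = R (algebraMap ℝ 𝕜 rp + x * (algebraMap ℝ 𝕜 rm - algebraMap ℝ 𝕜 rp))) →
      (IsSolutionOn P.Delta P.radialB P.radialC
          ((fun x => algebraMap ℝ 𝕜 rp + x * (algebraMap ℝ 𝕜 rm - algebraMap ℝ 𝕜 rp)) '' U) R ↔
        IsSolutionOn 1 (KNdS.preB z z₅) (KNdS.preC z Q L z₅ L₅) U Rz)) ∧
    -- the F-homotopic transformation, with any branches `exp (ν i * ℓ i)` of `(x - z i) ^ ν i`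
    (∀ {𝕜 : Type} [RCLike 𝕜] [NormedAlgebra 𝕜 ℂ] [IsScalarTower ℝ 𝕜 ℂ] (U : Set 𝕜), IsOpen U →
      (∀ x ∈ U, (∀ i, algebraMap 𝕜 ℂ x ≠ z i) ∧ algebraMap 𝕜 ℂ x ≠ z₅) →
      ∀ ℓ : Fin 4 → 𝕜 → ℂ, (∀ i, DifferentiableOn 𝕜 (ℓ i) U) →
      (∀ i, ∀ x ∈ U, Complex.exp (ℓ i x) = algebraMap 𝕜 ℂ x - z i) →
      ∀ R Rbar : 𝕜 → ℂ,
      (∀ x ∈ U, R (algebraMap ℝ 𝕜 rp + x * (algebraMap ℝ 𝕜 rm - algebraMap ℝ 𝕜 rp)) =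
        (∏ i, Complex.exp (ν i * ℓ i x)) * Rbar x) →
      (IsSolutionOn P.Delta P.radialB P.radialC
          ((fun x => algebraMap ℝ 𝕜 rp + x * (algebraMap ℝ 𝕜 rm - algebraMap ℝ 𝕜 rp)) '' U) R ↔
        IsSolutionOn 1 (KNdS.finalB z ν z₅) (KNdS.finalC z ν L z₅ L₅) U Rbar)) ∧
    -- exponents before the F-homotopic transformation
    (∀ i, HasExponents (KNdS.preB z z₅) (KNdS.preC z Q L z₅ L₅) (z i) (ν i) (1 / 2 - ν i)) ∧
    HasExponents (KNdS.preB z z₅) (KNdS.preC z Q L z₅ L₅) z₅ 0 2 ∧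
    -- the transformed equation is Fuchsian, with its finite singular points and their exponents
    IsFuchsian (KNdS.finalB z ν z₅) (KNdS.finalC z ν L z₅ L₅) ∧
    (∀ x : ℂ, (∀ i, x ≠ z i) → x ≠ z₅ →
      IsOrdinaryPoint (KNdS.finalB z ν z₅) (KNdS.finalC z ν L z₅ L₅) x) ∧
    (∀ i, HasExponents (KNdS.finalB z ν z₅) (KNdS.finalC z ν L z₅ L₅) (z i) 0 (1 / 2 - 2 * ν i)) ∧
    HasExponents (KNdS.finalB z ν z₅) (KNdS.finalC z ν L z₅ L₅) z₅ 0 2 ∧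
    IsRegularSingularPoint (KNdS.finalB z ν z₅) (KNdS.finalC z ν L z₅ L₅) z₅ ∧
    -- `z i` can fail to be a singular point only if `ν i = -1 / 4`, which does not occur when the
    -- energy and the radius are real
    (∀ i, ν i ≠ -1 / 4 ∨ (P.ω.im = 0 ∧ (KNdS.radius rp rm r₃ r₄ i).im = 0) →
      IsRegularSingularPoint (KNdS.finalB z ν z₅) (KNdS.finalC z ν L z₅ L₅) (z i)) := by
  obtain rfl : z = KNdS.zOf rp rm ∘ KNdS.radius rp rm r₃ r₄ := funext hz
  obtain rfl : Q = P.Q ∘ KNdS.radius rp rm r₃ r₄ := funext hQ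
  obtain rfl : L = P.L rp rm ∘ KNdS.radius rp rm r₃ r₄ := funext hL
  subst hz₅ hL₅
  have h := KNdS.hasSimpleRoots_deltaPoly hΛ hroot hinj
  have hrad : rp ≠ rm := fun h => hinj.ne zero_ne_one (congrArg Complex.ofReal h)
  have hz_inj := (KNdS.zOf_injective hrad).comp hinj
  have hz₅ (i) := (KNdS.zOf_injective hrad).ne (h₅ i)
  refine ⟨⟨KNdS.zOf_left rp rm, KNdS.zOf_right hrad, hz_inj, hz₅⟩, KNdS.Delta_eq_prod hΛ h hrad,
    fun U hU hUz R Rz hR => KNdS.isSolutionOn_radial_iff hμ h h₅ hrad hU hUz hR,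
    fun U hU hUz ℓ hℓ hexp R Rbar hR => ?_,
    fun i => KNdS.hasExponents_preB_preC hz_inj hz₅ _ _ _ _ (hν i),
    KNdS.hasExponents_preB_preC₅ hz_inj hz₅ _ _ _,
    KNdS.isFuchsian_finalB_finalC hz_inj hz₅ _ _ _ (KNdS.L₅_add_sum_L hμ h h₅ rp rm),
    fun x hx hx₅ => KNdS.isOrdinaryPoint_finalB_finalC _ _ _ _ _ hx hx₅,
    KNdS.hasExponents_finalB_finalC hz_inj hz₅ _ _ _,
    KNdS.hasExponents_finalB_finalC₅ hz_inj hz₅ _ _ _,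
    KNdS.isRegularSingularPoint_finalB_finalC₅ hz_inj hz₅ _ _ _,
    fun i hi => KNdS.isRegularSingularPoint_finalB_finalC hz_inj hz₅ _ _ _ <|
      hi.elim id fun ⟨hω, hr⟩ => KNdS.exponent_ne_neg_quarter hω hr (hν i)⟩
  rw [KNdS.isSolutionOn_radial_iff hμ h h₅ hrad hU hUz fun x hx => (hR x hx).symm]
  exact KNdS.isSolutionOn_preB_iff_finalB hz_inj hz₅ hν hU hUz hℓ hexp
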